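/- Let $\Sigma$ be a finite alphabet with $k\ge 2$ letters. For a language $L\subseteq\Sigma^*$ and a cost function $U:\Sigma\times\Sigma\to\mathbb{R}$, the free energy of $L$ is $$G_U(L)=\limsup_{n\to\infty}\frac1n\ln\sum_{w\in L,\ |w|=n}e^{(U)(w)},\qquad (U)(x_0\cdots x_{n-1})=\sum_{0\le i<n-1}U(x_i,x_{i+1}),$$ with the convention $\ln 0=0$. For $L \subseteq \Sigma^*$ let $L'=(\Sigma^*-L)\Sigma^*$. Already for the zero cost function $U=0$, the free energy of $L'$, where $L$ is a context-free language, is not computable. More precisely: 1. For every context-free language $L\subseteq\Sigma^*$, $G_0(L')=0$ if $L=\Sigma^*$, and $G_0(L')=\ln k$ otherwise (so $\ln 2$ over a two-letter alphabet). 2. There is no algorithm that, given a context-free grammar generating a language $L\subseteq\Sigma^*$ and a number $n\in\mathbb{N}$, returns an integer $z$ with $|z/2^n-G_0(L')|\le 2^{-n}$. -/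

import Mathlib

open Filter

/-- The cost `∑_{0 ≤ i < n-1} U (x_i, x_{i+1})` of a word `x_0 ⋯ x_{n-1}`. -/
def wordCost {α : Type} (U : α → α → ℝ) (w : List α) : ℝ :=
  (List.zipWith U w w.tail).sum

open Classical in
/-- The sum of `exp (cost of w)` over all words `w ∈ L` of length `n`. A word of length `n` is
given by its letters `x : Fin n → α`. -/
noncomputable def partitionSum {α : Type} [Fintype α] (U : α → α → ℝ) (L : Language α)
    (n : ℕ) : ℝ :=
  ∑ x : Fin n → α with List.ofFn x ∈ L, Real.exp (wordCost U (List.ofFn x))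

/-- The free energy of the language `L` for the cost function `U`. `Real.log 0 = 0` is the
convention `ln 0 = 0`; with it the sequence is bounded (by `ln |α| + max |U|` in absolute value),
so that the real-valued `limsup` is the usual one. -/
noncomputable def freeEnergy {α : Type} [Fintype α] (U : α → α → ℝ) (L : Language α) : ℝ :=
  limsup (fun n : ℕ => (1 / (n : ℝ)) * Real.log (partitionSum U L n)) atTop

/-- The language `(Σ* − L) Σ*`. -/
def complMulAll {α : Type} (L : Language α) : Language α := Lᶜ * ⊤

/-- Context-free grammars over the alphabet `Fin k`, written as finite data: the initial
nonterminal and the list of the rules (left-hand side, right-hand side). Nonterminals are named by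
natural numbers; in a right-hand side `Sum.inl a` is the letter `a` and `Sum.inr A` is the
nonterminal `A`. -/
abbrev GrammarCode (k : ℕ) : Type := ℕ × List (ℕ × List (Fin k ⊕ ℕ))

/-- A symbol of a rule, as a symbol of a context-free grammar. -/
def symbolOfSum {k : ℕ} : Fin k ⊕ ℕ → Symbol (Fin k) ℕ
  | Sum.inl a => Symbol.terminal a
  | Sum.inr A => Symbol.nonterminal A

/-- The context-free grammar that a code describes. -/
def GrammarCode.toGrammar {k : ℕ} (g : GrammarCode k) : ContextFreeGrammar (Fin k) where
  NT := ℕ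
  initial := g.1
  rules := (g.2.map fun r => ContextFreeRule.mk r.1 (r.2.map symbolOfSum)).toFinset

/-- A real-valued function is computable if some algorithm, given an argument `a` and a precision
`n`, returns an integer `z` such that the dyadic rational `z / 2 ^ n` is within `2⁻ⁿ` of `f a`. -/
def ComputableReal {α : Type} [Primcodable α] (f : α → ℝ) : Prop :=
  ∃ z : α → ℕ → ℤ, Computable₂ z ∧ ∀ a n, |(z a n : ℝ) / 2 ^ n - f a| ≤ 1 / 2 ^ n

/-! The free energy takes only two values. If `L` is everything, `L'` is empty. Otherwise some word
`w` lies outside `L`, every extension of `w` lies in `L'`, and so `L'` has at least `k ^ (n - |w|)`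
words of each length `n ≥ |w|`; the growth rate is then `ln k`. As `ln k ≥ ln 2` is bounded away
from `0`, an approximation to within `1/4` would decide universality of context-free grammars, and
it remains to see that this is undecidable (`not_computablePred_language_eq_top`).

The halting problem is first moved to iteration of one fixed map `g : ℕ → ℕ` that is affine on each
residue class of a modulus (`exists_residueAffine_iterate_eq_zero_iff`). Step-bounded evaluation is
primitive recursive, hence computed by a register program. Storing the registers as exponents of
distinct primes turns programs into lists of multiplications and divisibility tests on a single
number. Packing the instruction address into that number as a residue makes one step of the machine
residue-affine.

An orbit of `g` from `n` to `0` is then written in unary with separators. A word fails to be such a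
history exactly when it has a local defect: a wrong first value, a unary digit at the end, or two
neighbouring values `i`, `j` with `j ≠ g i`. Since `g` is affine on residue classes, a context-free
grammar can produce every mismatched pair by adding `M` digits on the left against `a` digits on the
right. No reversal of alternate values is needed, because only one adjacent pair is compared at a
time. The grammar thus generates all words if and only if the orbit of `n` misses `0`
(`language_nonHistoryGrammar_eq_top_iff`). -/

/-! ### Register programs compute all primitive recursive functions -/

/-- Programs acting on registers indexed by `ℕ`: `loop r P` repeats `P` as long as register `r` is
positive, decrementing `r` before each round. -/
inductive RegProg : Type
  | skip : RegProg
  | inc (r : ℕ) : RegProg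
  | seq (P Q : RegProg) : RegProg
  | loop (r : ℕ) (P : RegProg) : RegProg

namespace RegProg

open Finsupp

/-- `Exec P s s'`: started in `s`, the program `P` stops in `s'`. -/
inductive Exec : RegProg → (ℕ →₀ ℕ) → (ℕ →₀ ℕ) → Prop
  | skip (s) : Exec skip s s
  | inc (r s) : Exec (inc r) s (s + single r 1)
  | seq {P Q s s' s''} : Exec P s s' → Exec Q s' s'' → Exec (seq P Q) s s''
  | loop_zero {r P s} : s r = 0 → Exec (loop r P) s s
  | loop_succ {r P s s' s''} : Exec P s s' → Exec (loop r P) s' s'' →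
      Exec (loop r P) (s + single r 1) s''

theorem Exec.of_eq {P : RegProg} {s s' t t' : ℕ →₀ ℕ} (h : Exec P s s') (hs : s = t)
    (ht : s' = t') : Exec P t t' := hs ▸ ht ▸ h

/-- The loop invariant: `σ i` is the state after `i` rounds with the counter `r` removed. The body
is required to work for every remaining count `k`, which it must leave alone. -/
theorem exec_loop_iterate {r : ℕ} {P : RegProg} (σ : ℕ → ℕ →₀ ℕ) (hr : ∀ i, σ i r = 0)
    (h : ∀ i k, Exec P (σ i + single r k) (σ (i + 1) + single r k)) (n i : ℕ) :
    Exec (loop r P) (σ i + single r n) (σ (i + n)) := by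
  induction n generalizing i with
  | zero => simpa using Exec.loop_zero (hr i)
  | succ n ih =>
    rw [single_add, ← add_assoc]
    refine .loop_succ (h i n) ?_
    have := ih (i + 1)
    rwa [Nat.add_right_comm] at this

theorem exec_clear {r : ℕ} {s : ℕ →₀ ℕ} (hr : s r = 0) (n : ℕ) :
    Exec (loop r skip) (s + single r n) s :=
  exec_loop_iterate (fun _ => s) (fun _ => hr) (fun _ _ => .skip _) n 0

theorem exec_move {r a : ℕ} {s : ℕ →₀ ℕ} (hr : s r = 0) (ha : a ≠ r) (n : ℕ) :
    Exec (loop r (inc a)) (s + single r n) (s + single a n) := by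
  have := exec_loop_iterate (r := r) (P := inc a) (fun i => s + single a i)
    (fun i => by simp [hr, ha.symm])
    (fun i k => (Exec.inc a _).of_eq rfl (by rw [single_add]; abel)) n 0
  simpa using this

theorem exec_moveTwo {r a b : ℕ} {s : ℕ →₀ ℕ} (hr : s r = 0) (ha : a ≠ r) (hb : b ≠ r) (n : ℕ) :
    Exec (loop r (seq (inc a) (inc b))) (s + single r n) (s + single a n + single b n) := by
  have := exec_loop_iterate (r := r) (P := seq (inc a) (inc b))
    (fun i => s + single a i + single b i)
    (fun i => by simp [hr, ha.symm, hb.symm])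
    (fun i k => (Exec.seq (.inc a _) (.inc b _)).of_eq rfl (by simp only [single_add]; abel)) n 0
  simpa using this

/-- Add the content of `r` to `a`, with scratch register `t`. -/
def copy (r a t : ℕ) : RegProg := seq (loop r (seq (inc a) (inc t))) (loop t (inc r))

theorem exec_copy {r a t : ℕ} {s : ℕ →₀ ℕ} (ht : s t = 0) (hra : a ≠ r) (htr : t ≠ r)
    (hta : t ≠ a) : Exec (copy r a t) s (s + single a (s r)) := by
  have h0 : s.erase r + single r (s r) = s := by rw [add_comm]; exact single_add_erase r s
  have h1 := exec_moveTwo (s := s.erase r) (r := r) (a := a) (b := t) (by simp) hra htr (s r)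
  have h2 := exec_move (s := s.erase r + single a (s r)) (r := t) (a := r)
    (by simp [ht, hta, htr]) htr.symm (s r)
  refine (Exec.seq h1 h2).of_eq h0 ?_
  conv_rhs => rw [← h0]
  simp only [Finsupp.add_apply, erase_same, single_eq_same, zero_add]
  abel

/-- `f` is computed by programs that leave their input registers unchanged and use only scratch
registers from `b` on, which they find and leave empty. -/
def Computes {n : ℕ} (f : List.Vector ℕ n → ℕ) : Prop :=
  ∀ (b : ℕ) (ins : Fin n → ℕ) (out : ℕ), (∀ i, ins i < b) → out < b → (∀ i, ins i ≠ out) →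
    ∃ P, ∀ s : ℕ →₀ ℕ, (∀ j, b ≤ j → s j = 0) → s out = 0 →
      Exec P s (s + single out (f (List.Vector.ofFn fun i => s (ins i))))

theorem sum_single_apply_of_le {n b j : ℕ} (c : Fin n → ℕ) (h : j < b ∨ b + n ≤ j) :
    (∑ i : Fin n, single (b + i : ℕ) (c i)) j = 0 := by
  rw [finsetSum_apply]
  refine Finset.sum_eq_zero fun i _ => single_eq_of_ne ?_
  omega

theorem sum_single_apply_self {n b : ℕ} (c : Fin n → ℕ) (i : Fin n) :
    (∑ i : Fin n, single (b + i : ℕ) (c i)) (b + i) = c i := by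
  rw [finsetSum_apply, Finset.sum_eq_single i]
  · simp
  · intro j _ hj
    refine single_eq_of_ne ?_
    intro h
    exact hj (Fin.ext (by omega))
  · simp

/-- The `i`-th value goes to register `b + i` and is computed with scratch space above it, so
earlier results survive and the inputs, all below `b`, are still intact for the next function. -/
theorem exists_prog_pi {m n : ℕ} (g : Fin n → List.Vector ℕ m → ℕ) (hg : ∀ i, Computes (g i))
    (b : ℕ) (ins : Fin m → ℕ) (hins : ∀ i, ins i < b) :
    ∃ P, ∀ s : ℕ →₀ ℕ, (∀ j, b ≤ j → s j = 0) →
      Exec P s (s + ∑ i : Fin n,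
        single (b + i : ℕ) (g i (List.Vector.ofFn fun i => s (ins i)))) := by
  induction n with
  | zero => exact ⟨skip, fun s _ => by simpa using Exec.skip s⟩
  | succ n ih =>
    obtain ⟨P, hP⟩ := ih (fun i => g i.castSucc) fun i => hg _
    obtain ⟨Q, hQ⟩ := hg (Fin.last n) (b + n + 1) ins (b + n)
      (fun i => by have := hins i; omega) (by omega) (fun i => by have := hins i; omega)
    refine ⟨seq P Q, fun s hs => .seq (hP s hs) ?_⟩
    refine (hQ _ ?_ ?_).of_eq rfl ?_
    · intro j hj
      rw [Finsupp.add_apply, sum_single_apply_of_le _ (by omega), hs j (by omega)]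
    · rw [Finsupp.add_apply, sum_single_apply_of_le _ (by omega), hs _ (by omega)]
    · rw [Fin.sum_univ_castSucc, add_assoc]
      congr 5
      funext i
      rw [Finsupp.add_apply, sum_single_apply_of_le _ (Or.inl (hins i)), add_zero]

/-- Empty the registers `b, …, b + n - 1`. -/
def clearAll (b : ℕ) : ℕ → RegProg
  | 0 => skip
  | n + 1 => seq (loop (b + n) skip) (clearAll b n)

theorem exec_clearAll {b n : ℕ} (c : Fin n → ℕ) {s : ℕ →₀ ℕ} (hs : ∀ j, b ≤ j → s j = 0) :
    Exec (clearAll b n) (s + ∑ i : Fin n, single (b + i : ℕ) (c i)) s := by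
  induction n with
  | zero => simpa [clearAll] using Exec.skip s
  | succ n ih =>
    rw [Fin.sum_univ_castSucc, ← add_assoc]
    refine .seq (exec_clear ?_ _) (ih _)
    simp only [Fin.val_castSucc]
    rw [Finsupp.add_apply, sum_single_apply_of_le _ (by omega), hs _ (by omega)]

theorem Computes.comp {m n : ℕ} {f : List.Vector ℕ n → ℕ} (g : Fin n → List.Vector ℕ m → ℕ)
    (hf : Computes f) (hg : ∀ i, Computes (g i)) :
    Computes fun v => f (List.Vector.ofFn fun i => g i v) := by
  intro b ins out hins hout hne
  obtain ⟨P, hP⟩ := exists_prog_pi g hg b ins hins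
  obtain ⟨Q, hQ⟩ := hf (b + n) (fun i => b + i) out (fun i => by omega) (by omega)
    (fun i => by omega)
  refine ⟨seq P (seq Q (clearAll b n)), fun s hs ho => .seq (hP s hs) (.seq (hQ _ ?_ ?_) ?_)⟩
  · intro j hj
    rw [Finsupp.add_apply, sum_single_apply_of_le _ (by omega), hs j (by omega)]
  · rw [Finsupp.add_apply, sum_single_apply_of_le _ (by omega), ho]
  · simp only [Finsupp.add_apply, sum_single_apply_self]
    rw [add_right_comm]
    have h0 : ∀ i : Fin n, s (b + i) = 0 := fun i => hs _ (by omega)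
    simp only [h0, zero_add]
    refine exec_clearAll _ fun j hj => ?_
    rw [Finsupp.add_apply, hs j hj, single_eq_of_ne (by omega)]; rfl

theorem Computes.prec {n : ℕ} {f : List.Vector ℕ n → ℕ} {g : List.Vector ℕ (n + 2) → ℕ}
    (hf : Computes f) (hg : Computes g) :
    Computes fun v : List.Vector ℕ (n + 1) =>
      v.head.rec (f v.tail) fun y IH => g (y ::ᵥ IH ::ᵥ v.tail) := by
  intro b ins out hins hout hne
  obtain ⟨P, hP⟩ := hf b (fun i => ins i.succ) out (fun i => hins _) hout (fun i => hne _)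
  obtain ⟨Q, hQ⟩ := hg (b + 3) (Fin.cons (b + 1) (Fin.cons out fun i => ins i.succ)) (b + 2)
    (fun i => by
      refine Fin.cases ?_ (fun i => Fin.cases ?_ (fun i => ?_) i) i
      · simp
      · simp; omega
      · have := hins i.succ
        simp; omega) (by omega)
    (fun i => by
      refine Fin.cases ?_ (fun i => Fin.cases ?_ (fun i => ?_) i) i
      · simp
      · simp; omega
      · have := hins i.succ
        simp; omega)
  -- Register `b` counts the remaining rounds, `b + 1` holds the recursion index, `out` the current
  -- value and `b + 2` the next value before it replaces `out`.
  let body := seq Q (seq (loop out skip) (seq (loop (b + 2) (inc out)) (inc (b + 1))))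
  refine ⟨seq P (seq (copy (ins 0) b (b + 1)) (seq (loop b body) (loop (b + 1) skip))),
    fun s hs ho => ?_⟩
  set v : List.Vector ℕ n := List.Vector.ofFn fun i => s (ins i.succ) with hv
  let R : ℕ → ℕ := fun x => x.rec (f v) fun y IH => g (y ::ᵥ IH ::ᵥ v)
  let σ : ℕ → ℕ →₀ ℕ := fun i => s + single out (R i) + single (b + 1) i
  have hbody : ∀ i k, Exec body (σ i + single b k) (σ (i + 1) + single b k) := by
    intro i k
    have e1 := hQ (σ i + single b k)
      (fun j hj => by
        simp only [σ, Finsupp.add_apply]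
        rw [hs j (by omega), single_eq_of_ne (by omega), single_eq_of_ne (by omega),
          single_eq_of_ne (by omega)]; rfl)
      (by
        simp only [σ, Finsupp.add_apply]
        rw [hs _ (by omega), single_eq_of_ne (by omega), single_eq_of_ne (by omega),
          single_eq_of_ne (by omega)]; rfl)
    have harg : (List.Vector.ofFn fun j => (σ i + single b k)
        ((Fin.cons (b + 1) (Fin.cons out fun i => ins i.succ) : Fin (n + 2) → ℕ) j))
        = i ::ᵥ R i ::ᵥ v := by
      have h1 : (σ i + single b k) (b + 1) = i := by
        simp only [σ, Finsupp.add_apply]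
        rw [hs _ (by omega), single_eq_of_ne (by omega), single_eq_same,
          single_eq_of_ne (by omega)]
        omega
      have h2 : (σ i + single b k) out = R i := by
        simp only [σ, Finsupp.add_apply]
        rw [ho, single_eq_of_ne (by omega : out ≠ b + 1), single_eq_same,
          single_eq_of_ne (by omega)]
        omega
      have h3 : ∀ j : Fin n, (σ i + single b k) (ins j.succ) = s (ins j.succ) := by
        intro j
        have := hins j.succ
        have := hne j.succ
        simp only [σ, Finsupp.add_apply]
        rw [single_eq_of_ne (by omega), single_eq_of_ne (by omega),
          single_eq_of_ne (by omega)]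
        omega
      simp only [List.Vector.ofFn, Fin.cons_zero, Fin.cons_succ, h1, h2, h3, hv]
    rw [harg] at e1
    have e2 := exec_clear (r := out) (s := s + single (b + 1) i + single b k
        + single (b + 2) (R (i + 1)))
      (by
        simp only [Finsupp.add_apply]
        rw [ho, single_eq_of_ne (by omega), single_eq_of_ne (by omega),
          single_eq_of_ne (by omega)]; rfl) (R i)
    have e3 := exec_move (r := b + 2) (a := out) (s := s + single (b + 1) i + single b k)
      (by
        simp only [Finsupp.add_apply]
        rw [hs _ (by omega), single_eq_of_ne (by omega), single_eq_of_ne (by omega)]; rfl)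
      (by omega) (R (i + 1))
    refine (Exec.seq e1 ((Exec.seq (s' := s + single (b + 1) i + single b k
        + single (b + 2) (R (i + 1))) e2 (.seq e3 (.inc _ _))).of_eq ?_ rfl)).of_eq rfl ?_
    · simp only [σ, R]; abel
    · simp only [σ, single_add]; abel
  have e0 := hP s hs ho
  have e1 := exec_copy (r := ins 0) (a := b) (t := b + 1) (s := s + single out (f v))
    (by rw [Finsupp.add_apply, hs _ (by omega), single_eq_of_ne (by omega)]; rfl)
    (by have := hins 0; omega) (by have := hins 0; omega) (by omega)
  have e2 := exec_loop_iterate σ (r := b)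
    (fun i => by
      simp only [σ, Finsupp.add_apply]
      rw [hs _ le_rfl, single_eq_of_ne (by omega), single_eq_of_ne (by omega)]; rfl)
    hbody (s (ins 0)) 0
  have e3 := exec_clear (r := b + 1) (s := s + single out (R (s (ins 0))))
    (by rw [Finsupp.add_apply, hs _ (by omega), single_eq_of_ne (by omega)]; rfl) (s (ins 0))
  rw [zero_add] at e2
  have h0 : (s + single out (f v)) (ins 0) = s (ins 0) := by
    rw [Finsupp.add_apply, single_eq_of_ne (hne 0), add_zero]
  rw [h0] at e1
  refine (Exec.seq e0 (.seq e1 ((Exec.seq e2 e3).of_eq ?_ rfl))).of_eq rfl ?_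
  · simp [σ, R]
  · simp [R, List.Vector.ofFn, hv]

theorem computes_of_primrec' {n : ℕ} {f : List.Vector ℕ n → ℕ} (hf : Nat.Primrec' f) :
    Computes f := by
  induction hf with
  | zero => exact fun b ins out _ _ _ => ⟨skip, fun s _ _ => by simpa using Exec.skip s⟩
  | succ =>
    intro b ins out hins hout hne
    refine ⟨seq (copy (ins 0) out b) (inc out), fun s hs ho => ?_⟩
    refine (Exec.seq (exec_copy (hs b le_rfl) (hne 0).symm ?_ ?_) (.inc _ _)).of_eq rfl ?_
    · exact (hins 0).ne'
    · exact hout.ne'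
    · rw [add_assoc, ← single_add]; rfl
  | get i =>
    intro b ins out hins hout hne
    refine ⟨copy (ins i) out b, fun s hs ho => ?_⟩
    refine (exec_copy (hs b le_rfl) (hne i).symm ?_ ?_).of_eq rfl ?_
    · exact (hins i).ne'
    · exact hout.ne'
    · simp
  | comp g _ _ hf hg => exact hf.comp g hg
  | prec _ _ hf hg => exact hf.prec hg

end RegProg

/-! ### Arithmetic machines and their residue-affine step function -/

/-- Instructions acting on a positive number `x`: `mul p e` multiplies it by `p` and goes to `e`;
`div p a b` divides it by `p` and goes to `a` if this is possible and goes to `b` otherwise. -/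
inductive Instr : Type
  | mul (p e : ℕ) : Instr
  | div (p a b : ℕ) : Instr

namespace Instr

/-- The configuration after an instruction; the number `e + S * x` stands for the address `e` and
the content `x`. -/
def next (S : ℕ) : Instr → ℕ → ℕ
  | mul p e, x => e + S * (p * x)
  | div p a b, x => if p ∣ x then a + S * (x / p) else b + S * x

/-- The divisor that an instruction tests. -/
def divisor : Instr → ℕ
  | mul _ _ => 1
  | div p _ _ => p

/-- One step of the machine with the given code. -/
def step (code : List Instr) (n : ℕ) : ℕ :=
  (code.getD (n % code.length) (mul 0 0)).next code.length (n / code.length)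

theorem step_eq {code l r : List Instr} {i : Instr} (h : code = l ++ i :: r) (x : ℕ) :
    step code (l.length + code.length * x) = i.next code.length x := by
  have hl : l.length < code.length := by rw [h]; simp
  rw [step, Nat.add_mul_mod_self_left, Nat.mod_eq_of_lt hl,
    Nat.add_mul_div_left _ _ (by omega), Nat.div_eq_of_lt hl, zero_add]
  congr 1
  rw [List.getD_eq_getElem?_getD]
  conv_lhs => rw [h]
  simp

end Instr

/-- `g` is affine on each residue class of some modulus. -/
def ResidueAffine (g : ℕ → ℕ) : Prop :=
  ∃ M, 0 < M ∧ ∀ r < M, ∃ a, ∀ q, g (r + M * q) = g r + a * q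

/-- Adding a multiple of `D` does not change the outcome of the divisibility test, so the same
affine branch applies throughout. -/
theorem Instr.next_add_mul {S D : ℕ} (i : Instr) (hpos : 0 < i.divisor) (hi : i.divisor ∣ D)
    (x : ℕ) : ∃ a, ∀ q, i.next S (x + D * q) = i.next S x + a * q := by
  cases i with
  | mul p e => exact ⟨S * p * D, fun q => by simp only [next]; ring⟩
  | div p a b =>
    simp only [divisor] at hpos hi
    obtain ⟨d, rfl⟩ := hi
    by_cases h : p ∣ x
    · refine ⟨S * d, fun q => ?_⟩
      have h' : p ∣ x + p * d * q := Dvd.dvd.add h ⟨d * q, by ring⟩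
      simp only [next, h, h', if_true]
      rw [mul_assoc p, Nat.add_mul_div_left _ _ hpos]
      ring
    · refine ⟨S * (p * d), fun q => ?_⟩
      have h' : ¬ p ∣ x + p * d * q := by
        rwa [Nat.dvd_add_left ⟨d * q, by ring⟩]
      simp only [next, h, h', if_false]
      ring

theorem Instr.residueAffine_step {code : List Instr} (hne : code ≠ [])
    (hpos : ∀ i ∈ code, 0 < i.divisor) : ResidueAffine (step code) := by
  have hS : 0 < code.length := List.length_pos_iff.2 hne
  have hD : 0 < (code.map divisor).prod :=
    Nat.pos_of_ne_zero fun h => by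
      obtain ⟨i, hi, h0⟩ := List.mem_map.1 (List.prod_eq_zero_iff.1 h)
      exact (hpos i hi).ne' h0
  -- A residue for this modulus fixes both the address and the outcome of every divisibility test in
  -- the code.
  refine ⟨code.length * (code.map divisor).prod, Nat.mul_pos hS hD, fun r _ => ?_⟩
  have hlt : r % code.length < code.length := Nat.mod_lt _ hS
  obtain ⟨a, ha⟩ := next_add_mul (S := code.length) code[r % code.length]
    (hpos _ (List.getElem_mem hlt))
    (List.dvd_prod (List.mem_map_of_mem (f := divisor) (List.getElem_mem hlt)))
    (r / code.length)
  refine ⟨a, fun q => ?_⟩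
  simp only [step]
  rw [mul_assoc, Nat.add_mul_mod_self_left, Nat.add_mul_div_left _ _ hS,
    List.getD_eq_getElem _ _ hlt]
  exact ha q

/-! ### Compiling register programs to arithmetic machines -/

namespace RegProg

open Finsupp Instr

/-- The number that encodes a register state. -/
noncomputable def stateCode (s : ℕ →₀ ℕ) : ℕ := s.prod fun r e => Nat.nth Nat.Prime r ^ e

theorem stateCode_add (s t : ℕ →₀ ℕ) : stateCode (s + t) = stateCode s * stateCode t :=
  prod_add_index' (by simp) (by simp [pow_add])

theorem stateCode_single (r n : ℕ) : stateCode (single r n) = Nat.nth Nat.Prime r ^ n :=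
  prod_single_index (by simp)

/-- Distinct registers have distinct primes, so divisibility by the prime of `r` is the test whether
register `r` is positive. -/
theorem not_dvd_stateCode {r : ℕ} {s : ℕ →₀ ℕ} (h : s r = 0) :
    ¬ Nat.nth Nat.Prime r ∣ stateCode s := by
  intro hd
  obtain ⟨i, hi, hdi⟩ := (Nat.prime_nth_prime r).prime.exists_mem_finset_dvd hd
  have h1 := (Nat.prime_dvd_prime_iff_eq (Nat.prime_nth_prime r) (Nat.prime_nth_prime i)).1
    ((Nat.prime_nth_prime r).dvd_of_dvd_pow hdi)
  have h2 := Nat.nth_injective Nat.infinite_setOfPred_prime h1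
  rw [← h2] at hi
  exact (mem_support_iff.1 hi) h

/-- The number of instructions of a compiled program. -/
def size : RegProg → ℕ
  | skip => 1
  | inc _ => 1
  | seq P Q => P.size + Q.size
  | loop _ P => P.size + 1

/-- The code of a program placed at address `o`, which continues at address `e`. -/
noncomputable def compile : RegProg → ℕ → ℕ → List Instr
  | skip, _, e => [.mul 1 e]
  | inc r, _, e => [.mul (Nat.nth Nat.Prime r) e]
  | seq P Q, o, e => compile P o (o + P.size) ++ compile Q (o + P.size) e
  | loop r P, o, e => .div (Nat.nth Nat.Prime r) (o + 1) e :: compile P (o + 1) o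

theorem length_compile (P : RegProg) (o e : ℕ) : (P.compile o e).length = P.size := by
  induction P generalizing o e <;> simp_all [compile, size]

theorem divisor_pos_of_mem_compile (P : RegProg) (o e : ℕ) :
    ∀ i ∈ P.compile o e, 0 < i.divisor := by
  induction P generalizing o e with
  | skip => simp [compile, divisor]
  | inc r => simp [compile, divisor]
  | seq P Q ihP ihQ =>
    intro i hi
    rcases List.mem_append.1 hi with h | h
    exacts [ihP _ _ i h, ihQ _ _ i h]
  | loop r P ih =>
    intro i hi
    rcases List.mem_cons.1 hi with rfl | h
    exacts [(Nat.prime_nth_prime r).pos, ih _ _ i h]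

theorem step_loop_pos {code l t : List Instr} {r : ℕ} {P : RegProg} {e : ℕ}
    (h : code = l ++ ((loop r P).compile l.length e ++ t)) (s : ℕ →₀ ℕ) :
    step code (l.length + code.length * stateCode (s + single r 1)) =
      l.length + 1 + code.length * stateCode s := by
  rw [step_eq h, next, if_pos, stateCode_add, stateCode_single, pow_one,
    Nat.mul_div_cancel _ (Nat.prime_nth_prime r).pos]
  rw [stateCode_add, stateCode_single, pow_one]
  exact Dvd.intro_left _ rfl

/-- Induction on the execution, for any placement of the compiled block inside the code. A loop body
is compiled to continue at the address of the loop's own test, so the remaining rounds are covered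
by the hypothesis for the same block. -/
theorem Exec.exists_iterate_step {P : RegProg} {s s' : ℕ →₀ ℕ} (hP : Exec P s s')
    {code l r : List Instr} {e : ℕ} (h : code = l ++ (P.compile l.length e ++ r)) :
    ∃ t, (step code)^[t] (l.length + code.length * stateCode s) =
      e + code.length * stateCode s' := by
  induction hP generalizing l r e with
  | skip s => exact ⟨1, by rw [Function.iterate_one, step_eq h, next, one_mul]⟩
  | inc q s =>
    refine ⟨1, ?_⟩
    rw [Function.iterate_one, step_eq h, next, stateCode_add, stateCode_single, pow_one,
      mul_comm (stateCode s)]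
  | @seq P Q s s' s'' _ _ ihP ihQ =>
    obtain ⟨t₁, h₁⟩ := ihP (l := l) (e := l.length + P.size)
      (r := Q.compile (l.length + P.size) e ++ r) (by rw [h, compile, List.append_assoc])
    obtain ⟨t₂, h₂⟩ := ihQ (l := l ++ P.compile l.length (l.length + P.size)) (e := e) (r := r)
      (by rw [h, compile]; simp [length_compile])
    rw [List.length_append, length_compile] at h₂
    exact ⟨t₂ + t₁, by rw [Function.iterate_add_apply, h₁, h₂]⟩
  | @loop_zero q P s hs =>
    exact ⟨1, by rw [Function.iterate_one, step_eq h, next, if_neg (not_dvd_stateCode hs)]⟩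
  | @loop_succ q P s s' s'' _ _ ihP ihL =>
    obtain ⟨t₁, h₁⟩ := ihP (l := l ++ [.div (Nat.nth Nat.Prime q) (l.length + 1) e])
      (e := l.length) (r := r) (by rw [h, compile]; simp)
    obtain ⟨t₂, h₂⟩ := ihL h
    rw [List.length_append, List.length_singleton] at h₁
    refine ⟨t₂ + (t₁ + 1), ?_⟩
    rw [Function.iterate_add_apply, Function.iterate_add_apply, Function.iterate_one,
      step_loop_pos h, h₁, h₂]

end RegProg

/-! ### Unbounded search as an orbit reaching zero -/

open RegProg Finsupp Instr in
theorem exists_residueAffine_iterate_eq_zero_iff {f : ℕ → ℕ → ℕ} (hf : Primrec₂ f)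
    (hle : ∀ x m, f x m ≤ 1) :
    ∃ g, ResidueAffine g ∧ ∃ ι : ℕ → ℕ, Primrec ι ∧ (∀ x, 0 < ι x) ∧
      ∀ x, (∃ t, g^[t] (ι x) = 0) ↔ ∃ m, f x m = 0 := by
  obtain ⟨P, hP⟩ := computes_of_primrec' (Nat.Primrec'.prim_iff₂.2 hf) 3 ![0, 1] 2
    (by simp [Fin.forall_fin_two]) (by simp) (by simp [Fin.forall_fin_two])
  -- Register `0` holds `x`, register `1` the candidate `m`, register `2` the flag `f x m`. The
  -- search loop runs on the flag, which each round consumes and recomputes.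
  let body := seq P (inc 1)
  let σ : ℕ → ℕ → ℕ →₀ ℕ := fun x m => single 0 x + single 1 m
  have hbody : ∀ x m, Exec body (σ x m) (σ x (m + 1) + single 2 (f x m)) := by
    intro x m
    have h := hP (σ x m) (fun j hj => by
      simp only [σ, Finsupp.add_apply]
      rw [single_eq_of_ne (by omega), single_eq_of_ne (by omega)]; rfl) (by simp [σ])
    refine (Exec.seq h (.inc 1 _)).of_eq rfl ?_
    have : (List.Vector.ofFn fun i => σ x m ((![0, 1] : Fin 2 → ℕ) i)) = x ::ᵥ m ::ᵥ .nil := by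
      simp [List.Vector.ofFn, σ]
    rw [this]
    simp only [List.Vector.head_cons, List.Vector.tail_cons, σ, single_add]
    abel
  -- The search loop sits at address `1` and exits to address `0`, where multiplication by `0` wipes
  -- the content. Halting thus means reaching the number `0`, a fixed point.
  let code : List Instr := [.mul 0 0] ++ ((loop 2 body).compile 1 0 ++ [])
  have hcode : code = [.mul 0 0] ++ ((loop 2 body).compile [Instr.mul 0 0].length 0 ++ []) := rfl
  have hhalt : ∀ x, step code (0 + code.length * x) = 0 := fun x =>
    (step_eq (l := []) rfl x).trans (by simp [next])
  let c : ℕ → ℕ → ℕ := fun x m => 1 + code.length * stateCode (σ x m + single 2 1)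
  refine ⟨step code, residueAffine_step (by simp [code]) ?_, fun x => c x 0, ?_, ?_, ?_⟩
  · intro i hi
    simp only [code, List.append_nil, List.singleton_append, List.mem_cons] at hi
    rcases hi with rfl | hi
    exacts [Nat.one_pos, divisor_pos_of_mem_compile _ _ _ i hi]
  · have hpow : Primrec fun x : ℕ => Nat.nth Nat.Prime 0 ^ x := by
      have : Primrec₂ ((· ^ ·) : ℕ → ℕ → ℕ) := Primrec₂.unpaired'.1 Nat.Primrec.pow
      exact this.comp (Primrec.const _) Primrec.id
    refine (Primrec.nat_add.comp (Primrec.const 1) (Primrec.nat_mul.comp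
      (Primrec.const (code.length * stateCode (single 2 1))) hpow)).of_eq fun x => ?_
    simp only [c, σ, stateCode_add, stateCode_single, pow_zero]
    ring
  · intro x
    simp [c]
  · intro x
    constructor
    · rintro ⟨t, ht⟩
      by_contra! hne
      have h1 : ∀ m, f x m = 1 := fun m => by have := hle x m; have := hne m; omega
      -- Each round takes at least one step, so if the flag is always `1`, the orbit visits the
      -- positive numbers `c x m` at arbitrarily late times. This is impossible once it is stuck at
      -- the fixed point `0`.
      have hloop : ∀ m, ∃ t, (step code)^[t + 1] (c x m) = c x (m + 1) := by
        intro m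
        obtain ⟨t, ht⟩ := (hbody x m).exists_iterate_step (code := code) (e := 1) (r := [])
          (l := [.mul 0 0] ++ [.div (Nat.nth Nat.Prime 2) (1 + 1) 0]) (by simp [code, compile])
        rw [h1] at ht
        refine ⟨t, ?_⟩
        rw [Function.iterate_succ_apply]
        exact (congrArg _ (step_loop_pos hcode _)).trans ht
      have hlarge : ∀ m, ∃ T, m ≤ T ∧ (step code)^[T] (c x 0) = c x m := by
        intro m
        induction m with
        | zero => exact ⟨0, le_rfl, rfl⟩
        | succ m ih =>
          obtain ⟨T, hT, h⟩ := ih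
          obtain ⟨t, ht⟩ := hloop m
          exact ⟨t + 1 + T, by omega, by rw [Function.iterate_add_apply, h, ht]⟩
      obtain ⟨T, hT, h⟩ := hlarge t
      obtain ⟨d, rfl⟩ := Nat.exists_eq_add_of_le' hT
      have h0 : Function.IsFixedPt (step code) 0 := hhalt 0
      rw [Function.iterate_add_apply, ht, (h0.iterate d)] at h
      simp only [c] at h
      omega
    · rintro ⟨m, hm⟩
      -- Induction on the distance `n` to a known zero of `f x`; the loop may already stop at an
      -- earlier one.
      have hterm : ∀ n m, f x (m + n) = 0 → ∃ s, Exec (loop 2 body) (σ x m + single 2 1) s := by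
        intro n
        induction n with
        | zero =>
          intro m hm
          have := hbody x m
          rw [add_zero] at hm
          rw [hm, single_zero, add_zero] at this
          exact ⟨_, .loop_succ this (.loop_zero (by simp [σ]))⟩
        | succ n ih =>
          intro m hm
          have hb := hbody x m
          rcases Nat.le_one_iff_eq_zero_or_eq_one.1 (hle x m) with h | h
          · rw [h, single_zero, add_zero] at hb
            exact ⟨_, .loop_succ hb (.loop_zero (by simp [σ]))⟩
          · rw [h] at hb
            obtain ⟨s, hs⟩ := ih (m + 1) (by rwa [Nat.add_right_comm])
            exact ⟨s, .loop_succ hb hs⟩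
      obtain ⟨s, hs⟩ := hterm m 0 (by rwa [zero_add])
      obtain ⟨t, ht⟩ := hs.exists_iterate_step hcode
      refine ⟨1 + t, ?_⟩
      rw [Function.iterate_add_apply]
      exact (congrArg _ ht).trans (hhalt _)

/-! ### Interpreting nonterminals by languages -/

namespace ContextFreeGrammar

variable {T : Type*}

/-- `w` is obtained from a string of symbols by replacing each nonterminal `A` by a word of
`I A`. -/
def Matches {N : Type*} (I : N → Language T) : List (Symbol T N) → List T → Prop
  | [], w => w = []
  | .terminal a :: s, w => ∃ v, w = a :: v ∧ Matches I s v
  | .nonterminal A :: s, w => ∃ x ∈ I A, ∃ v, w = x ++ v ∧ Matches I s v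

theorem matches_append {N : Type*} {I : N → Language T} {s t : List (Symbol T N)} {w : List T} :
    Matches I (s ++ t) w ↔ ∃ x y, w = x ++ y ∧ Matches I s x ∧ Matches I t y := by
  induction s generalizing w with
  | nil => simp [Matches]
  | cons a s ih =>
    cases a with
    | terminal a =>
      simp only [List.cons_append, Matches, ih]
      constructor
      · rintro ⟨v, rfl, x, y, rfl, hx, hy⟩
        exact ⟨a :: x, y, rfl, ⟨x, rfl, hx⟩, hy⟩
      · rintro ⟨_, y, rfl, ⟨x, rfl, hx⟩, hy⟩
        exact ⟨x ++ y, rfl, x, y, rfl, hx, hy⟩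
    | nonterminal A =>
      simp only [List.cons_append, Matches, ih]
      constructor
      · rintro ⟨z, hz, v, rfl, x, y, rfl, hx, hy⟩
        exact ⟨z ++ x, y, by simp, ⟨z, hz, x, rfl, hx⟩, hy⟩
      · rintro ⟨_, y, rfl, ⟨z, hz, x, rfl, hx⟩, hy⟩
        exact ⟨z, hz, x ++ y, by simp, x, y, rfl, hx, hy⟩

theorem matches_map_terminal {N : Type*} {I : N → Language T} {v w : List T} :
    Matches I (v.map .terminal) w ↔ w = v := by
  induction v generalizing w with
  | nil => simp [Matches]
  | cons a v ih => simp [Matches, ih]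

theorem matches_replicate_append {N : Type*} {I : N → Language T} {n : ℕ} {a : T}
    {s : List (Symbol T N)} {w : List T} :
    Matches I (List.replicate n (.terminal a) ++ s) w ↔
      ∃ v, w = List.replicate n a ++ v ∧ Matches I s v := by
  rw [← List.map_replicate, matches_append]
  simp only [matches_map_terminal]
  simp

theorem matches_replicate {N : Type*} {I : N → Language T} {n : ℕ} {a : T} {w : List T} :
    Matches I (List.replicate n (.terminal a)) w ↔ w = List.replicate n a := by
  rw [← List.map_replicate, matches_map_terminal]

/-- The words derived from a nonterminal. -/
def derivedFrom (G : ContextFreeGrammar T) (A : G.NT) : Language T :=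
  {w | G.Derives [.nonterminal A] (w.map .terminal)}

variable {G : ContextFreeGrammar T}

theorem Produces.matches {I : G.NT → Language T}
    (h : ∀ r ∈ G.rules, ∀ w, Matches I r.output w → w ∈ I r.input)
    {s t : List (Symbol T G.NT)} (hst : G.Produces s t) {w : List T} (hw : Matches I t w) :
    Matches I s w := by
  obtain ⟨r, hr, hrw⟩ := hst
  obtain ⟨p, q, rfl, rfl⟩ := hrw.exists_parts
  rw [matches_append] at hw ⊢
  obtain ⟨x, y, rfl, hx, hy⟩ := hw
  rw [matches_append] at hx
  obtain ⟨x₁, x₂, rfl, hx₁, hx₂⟩ := hx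
  refine ⟨x₁ ++ x₂, y, rfl, ?_, hy⟩
  rw [matches_append]
  exact ⟨x₁, x₂, rfl, hx₁, x₂, h r hr _ hx₂, [], by simp, rfl⟩

/-- The soundness principle: an assignment of languages closed under all rules bounds what is
derivable. A derivation is read backwards from its final word, undoing one rule at a time. -/
theorem mem_of_mem_language_of_matches {I : G.NT → Language T}
    (h : ∀ r ∈ G.rules, ∀ w, Matches I r.output w → w ∈ I r.input) :
    ∀ w ∈ G.language, w ∈ I G.initial := by
  intro w hw
  have key : ∀ s, G.Derives s (w.map .terminal) → Matches I s w := by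
    intro s hs
    induction hs using Relation.ReflTransGen.head_induction_on with
    | refl => exact matches_map_terminal.2 rfl
    | head hp _ ih => exact hp.matches h ih
  obtain ⟨x, hx, v, rfl, hv⟩ := key _ hw
  simp only [Matches] at hv
  simpa [hv] using hx

/-- The completeness counterpart: derivations of the separate symbols are concatenated. It lets
membership be proved rule by rule without handling derivations. -/
theorem derives_of_matches {s : List (Symbol T G.NT)} {w : List T}
    (h : Matches G.derivedFrom s w) : G.Derives s (w.map .terminal) := by
  induction s generalizing w with
  | nil => rw [show w = [] from h]; exact .refl _
  | cons a s ih =>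
    cases a with
    | terminal a =>
      obtain ⟨v, rfl, hv⟩ := h
      exact (ih hv).append_left [.terminal a]
    | nonterminal A =>
      obtain ⟨x, hx, v, rfl, hv⟩ := h
      rw [List.map_append]
      exact (Derives.append_right hx s).trans ((ih hv).append_left _)

theorem mem_derivedFrom_of_rule {A : G.NT} {s : List (Symbol T G.NT)} (hr : ⟨A, s⟩ ∈ G.rules)
    {w : List T} (h : Matches G.derivedFrom s w) : w ∈ G.derivedFrom A :=
  Produces.trans_derives ⟨_, hr, ContextFreeRule.Rewrites.input_output⟩ (derives_of_matches h)

end ContextFreeGrammar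

theorem GrammarCode.mem_rules {k : ℕ} (g : GrammarCode k) (r : ContextFreeRule (Fin k) ℕ) :
    r ∈ g.toGrammar.rules ↔ ∃ p ∈ g.2, ContextFreeRule.mk p.1 (p.2.map symbolOfSum) = r :=
  List.mem_toFinset.trans List.mem_map

/-! ### Unary histories of orbits -/

section Histories

open List

variable {α : Type*} {u : α}

theorem replicate_append_cons_inj {i j : ℕ} {c d : α} {v w : List α} (hc : c ≠ u) (hd : d ≠ u)
    (h : replicate i u ++ c :: v = replicate j u ++ d :: w) : i = j ∧ c = d ∧ v = w := by
  induction i generalizing j with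
  | zero =>
    cases j with
    | zero => simpa using h
    | succ j => simp [replicate_succ, hc] at h
  | succ i ih =>
    cases j with
    | zero => simp [replicate_succ, hd.symm] at h
    | succ j =>
      simp only [replicate_succ, cons_append, cons.injEq, true_and] at h
      simpa using ih h

theorem eq_replicate_or_exists_ne (u : α) (w : List α) :
    (∃ n, w = replicate n u) ∨ ∃ n c v, c ≠ u ∧ w = replicate n u ++ c :: v := by
  induction w with
  | nil => exact .inl ⟨0, rfl⟩
  | cons a w ih =>
    by_cases ha : a = u
    · subst ha
      rcases ih with ⟨n, rfl⟩ | ⟨n, c, v, hc, rfl⟩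
      · exact .inl ⟨n + 1, rfl⟩
      · exact .inr ⟨n + 1, c, v, hc, rfl⟩
    · exact .inr ⟨0, a, w, ha, rfl⟩

/-- `w` records, in unary notation, an orbit of `g` that starts in `m` and ends in `0`; the values
are separated by letters different from the unary digit `u`. -/
inductive IsHistory (u : α) (g : ℕ → ℕ) : ℕ → List α → Prop
  | nil : IsHistory u g 0 []
  | cons {m c w} : c ≠ u → IsHistory u g (g m) w → IsHistory u g m (replicate m u ++ c :: w)

namespace IsHistory

variable {g : ℕ → ℕ} {m : ℕ} {w : List α}

theorem exists_iff {z : α} (hz : z ≠ u) :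
    (∃ w, IsHistory u g m w) ↔ ∃ t, g^[t] m = 0 := by
  constructor
  · rintro ⟨w, h⟩
    induction h with
    | nil => exact ⟨0, rfl⟩
    | cons _ _ ih =>
      obtain ⟨t, ht⟩ := ih
      exact ⟨t + 1, ht⟩
  · rintro ⟨t, ht⟩
    induction t generalizing m with
    | zero => exact ⟨[], by rw [show m = 0 from ht]; exact .nil⟩
    | succ t ih =>
      obtain ⟨w, hw⟩ := ih ht
      exact ⟨_, .cons hz hw⟩

/-- The final value `0` is an empty block with no separator after it, so a nonempty history ends in
the separator before it. -/
theorem getLast?_ne (h : IsHistory u g m w) : w.getLast? ≠ some u := by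
  induction h with
  | nil => simp
  | @cons m c w hc _ ih =>
    rcases eq_or_ne w [] with rfl | hw
    · simpa using hc
    · rw [getLast?_append_cons, getLast?_cons_of_ne_nil hw]
      exact ih

theorem of_cons {j : ℕ} {c : α} (hc : c ≠ u) (h : IsHistory u g m (replicate j u ++ c :: w)) :
    j = m ∧ IsHistory u g (g m) w := by
  generalize hx : replicate j u ++ c :: w = x at h
  cases h with
  | nil => simp at hx
  | cons hd h =>
    obtain ⟨rfl, rfl, rfl⟩ := replicate_append_cons_inj hc hd hx
    exact ⟨rfl, h⟩

theorem eq_zero_of_replicate {j : ℕ} (h : IsHistory u g m (replicate j u)) : m = 0 ∧ j = 0 := by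
  generalize hx : replicate j u = x at h
  cases h with
  | nil => simpa using hx
  | @cons _ c w hc _ =>
    have : c ∈ replicate j u := by rw [hx]; simp
    exact absurd (eq_of_mem_replicate this) hc

theorem not_replicate_append : ¬ IsHistory u g m (replicate (m + 1) u ++ w) := by
  intro h
  rcases eq_replicate_or_exists_ne u w with ⟨n, rfl⟩ | ⟨n, c, v, hc, rfl⟩
  · rw [replicate_append_replicate] at h
    have := h.eq_zero_of_replicate
    omega
  · rw [← append_assoc, replicate_append_replicate] at h
    have := (h.of_cons hc).1
    omega

/-- The conditions on `x` and `y` say that the two unary blocks are maximal, hence are genuine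
consecutive values. Leading values are stripped from `x` until the pair is in front. -/
theorem eq_of_adjacent {x y : List α} {a b : ℕ} {c : α} (hx : x.getLast? ≠ some u)
    (hy : y.head? ≠ some u) (hc : c ≠ u)
    (h : IsHistory u g m (x ++ (replicate a u ++ c :: (replicate b u ++ y)))) : b = g a := by
  generalize hn : x.length = n
  induction n using Nat.strong_induction_on generalizing x m with
  | _ n ih =>
    rcases eq_replicate_or_exists_ne u x with ⟨j, rfl⟩ | ⟨j, d, x', hd, rfl⟩
    · cases j with
      | zero =>
        simp only [replicate_zero, nil_append] at h
        obtain ⟨rfl, h⟩ := h.of_cons hc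
        cases y with
        | nil =>
          rw [append_nil] at h
          have := h.eq_zero_of_replicate
          omega
        | cons d y => exact (h.of_cons (by simpa using hy)).1
      | succ j => simp [replicate_succ'] at hx
    · rw [append_assoc, cons_append] at h
      refine ih x'.length ?_ ?_ (h.of_cons hd).2 rfl
      · simp at hn; omega
      · rcases eq_or_ne x' [] with rfl | hne
        · simp
        · rwa [getLast?_append_cons, getLast?_cons_of_ne_nil hne] at hx

/-- A word without adjacent values that contradict `g` is a history. -/
theorem of_forall_adjacent (hlast : w.getLast? ≠ some u)
    (h : ∀ x a c b y, w = x ++ (replicate a u ++ c :: (replicate b u ++ y)) → c ≠ u →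
      x.getLast? ≠ some u → y.head? ≠ some u → b = g a)
    {x v : List α} {c : α} (hw : w = x ++ (replicate m u ++ c :: v)) (hc : c ≠ u)
    (hx : x.getLast? ≠ some u) : IsHistory u g (g m) v := by
  generalize hn : v.length = n
  induction n using Nat.strong_induction_on generalizing x v c m with
  | _ n ih =>
    rcases eq_replicate_or_exists_ne u v with ⟨b, rfl⟩ | ⟨b, d, v', hd, rfl⟩
    -- The remaining block is the last value; as the word does not end in `u`, it is empty and the
    -- orbit has arrived at `0`.
    · have hb := h x m c b [] (by simpa using hw) hc hx (by simp)
      cases b with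
      | zero => rw [← hb]; exact .nil
      | succ b =>
        refine absurd ?_ hlast
        rw [hw, replicate_succ', ← cons_append, ← append_assoc, ← append_assoc,
          getLast?_concat]
    · have hb := h x m c b (d :: v') hw hc hx (by simpa using hd)
      rw [← hb]
      refine .cons hd (ih v'.length (by simp at hn; omega)
        (x := x ++ replicate m u ++ [c]) ?_ hd ?_ rfl)
      · rw [hw]; simp
      · rw [getLast?_concat]; simpa using hc

end IsHistory

end Histories

/-! ### The grammar of non-histories: soundness -/

section HistoryGrammar

open List ContextFreeGrammar

variable {k : ℕ} (u : Fin k)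

/-- Rules deriving, from the nonterminal `r + 7`, the words `u ^ (r + M * q) c u ^ j` with a letter
`c ≠ u` and `j ≠ b + a * q`. -/
def mismatchRules (M r b a : ℕ) : List (ℕ × List (Fin k ⊕ ℕ)) :=
  [(r + 7, replicate M (.inl u) ++ .inr (r + 7) :: replicate a (.inl u)),
    (r + 7, replicate r (.inl u) ++ .inr 4 :: (replicate (b + 1) (.inl u) ++ [.inr 5]))] ++
  (range b).map (fun j => (r + 7, replicate r (.inl u) ++ .inr 4 :: replicate j (.inl u))) ++
  (range a).map (fun j => (r + 7, replicate M (.inl u) ++ .inr 6 ::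
    (replicate r (.inl u) ++ .inr 4 :: replicate j (.inl u))))

/-- The rules that do not depend on the initial value of the history. -/
def commonRules (M : ℕ) (g a : ℕ → ℕ) : List (ℕ × List (Fin k ⊕ ℕ)) :=
  [(0, []), (0, [.inr 1, .inl u]), (1, []), (2, []), (2, [.inr 1, .inr 4]), (3, []),
    (3, [.inr 4, .inr 1]), (5, []), (5, [.inl u, .inr 5]), (6, []),
    (6, replicate M (.inl u) ++ [.inr 6])] ++
  (finRange k).map (fun c => (1, [.inl c, .inr 1])) ++
  ((finRange k).filter (· ≠ u)).map (fun c => (4, [.inl c])) ++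
  (range M).map (fun r => (0, [.inr 2, .inr (r + 7), .inr 3])) ++
  (range M).flatMap fun r => mismatchRules u M r (g r) (a r)

/-- The rules deriving the words that do not start with `u ^ n c` for a letter `c ≠ u`. -/
def initialValueRules (n : ℕ) : List (ℕ × List (Fin k ⊕ ℕ)) :=
  (0, replicate (n + 1) (.inl u) ++ [.inr 1]) ::
    (range n).map fun j => (0, replicate j (.inl u) ++ [.inr 4, .inr 1])

/-- A grammar for the words that are not histories of `g` with initial value `n`. -/
def nonHistoryGrammar (M : ℕ) (g a : ℕ → ℕ) (n : ℕ) : GrammarCode k :=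
  (0, commonRules u M g a ++ initialValueRules u n)

/-- The languages of the nonterminals of `nonHistoryGrammar`. -/
def nonHistoryLanguages (M : ℕ) (g a : ℕ → ℕ) (n : ℕ) : ℕ → Language (Fin k)
  | 0 => {w | ¬ IsHistory u g n w}
  | 1 => ⊤
  | 2 => {w | w.getLast? ≠ some u}
  | 3 => {w | w.head? ≠ some u}
  | 4 => {w | ∃ c, c ≠ u ∧ w = [c]}
  | 5 => {w | ∃ j, w = replicate j u}
  | 6 => {w | ∃ q, w = replicate (M * q) u}
  | r + 7 => {w | ∃ q c j, c ≠ u ∧ j ≠ g r + a r * q ∧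
      w = replicate (r + M * q) u ++ c :: replicate j u}

variable {u} {M : ℕ} {g a : ℕ → ℕ} {n : ℕ}

theorem mem_of_matches_mismatchRules {r : ℕ} {p : ℕ × List (Fin k ⊕ ℕ)}
    (hp : p ∈ mismatchRules u M r (g r) (a r)) {w : List (Fin k)}
    (hw : Matches (nonHistoryLanguages u M g a n) (p.2.map symbolOfSum) w) :
    w ∈ nonHistoryLanguages u M g a n p.1 := by
  simp only [mismatchRules, mem_append, mem_cons, not_mem_nil, or_false, List.mem_map, mem_range] at hp
  rcases hp with ((rfl | rfl) | ⟨j, hj, rfl⟩) | ⟨j, hj, rfl⟩ <;>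
    simp only [map_append, map_cons, map_replicate, map_nil, symbolOfSum,
      matches_replicate_append, matches_replicate, Matches] at hw
  · obtain ⟨_, rfl, _, ⟨q, c, j, hc, hj, rfl⟩, _, rfl, rfl⟩ := hw
    refine ⟨q + 1, c, j + a r, hc, ?_, ?_⟩
    · rw [mul_add]; omega
    · rw [mul_add, mul_one, add_comm (M * q), ← add_assoc, add_comm r M, add_assoc]
      simp [-replicate_append_replicate, replicate_add]
  · obtain ⟨_, rfl, _, ⟨c, hc, rfl⟩, _, rfl, _, rfl, _, ⟨j, rfl⟩, _, rfl, rfl⟩ := hw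
    refine ⟨0, c, g r + 1 + j, hc, by omega, ?_⟩
    simp [-replicate_append_replicate, replicate_add]
  · obtain ⟨_, rfl, _, ⟨c, hc, rfl⟩, _, rfl, rfl⟩ := hw
    exact ⟨0, c, j, hc, by omega, by simp⟩
  · obtain ⟨_, rfl, _, ⟨q, rfl⟩, _, rfl, _, rfl, _, ⟨c, hc, rfl⟩, _, rfl, rfl⟩ := hw
    refine ⟨q + 1, c, j, hc, ?_, ?_⟩
    · rw [mul_add]; omega
    · rw [mul_add, mul_one, add_comm r, add_comm (M * q)]
      simp [-replicate_append_replicate, replicate_add]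

theorem mem_of_matches_commonRules (hg : ∀ r < M, ∀ q, g (r + M * q) = g r + a r * q)
    (hn : 0 < n) {p : ℕ × List (Fin k ⊕ ℕ)} (hp : p ∈ commonRules u M g a) {w : List (Fin k)}
    (hw : Matches (nonHistoryLanguages u M g a n) (p.2.map symbolOfSum) w) :
    w ∈ nonHistoryLanguages u M g a n p.1 := by
  simp only [commonRules, mem_append, mem_cons, not_mem_nil, or_false, List.mem_map, mem_range,
    mem_flatMap, mem_filter, mem_finRange, true_and, decide_eq_true_eq] at hp
  rcases hp with (((hp | ⟨c, rfl⟩) | ⟨c, hc, rfl⟩) | ⟨r, hr, rfl⟩) | ⟨r, _, hp⟩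
  · rcases hp with rfl | rfl | rfl | rfl | rfl | rfl | rfl | rfl | rfl | rfl | rfl <;>
      simp only [map_append, map_cons, map_replicate, map_nil, symbolOfSum,
        matches_replicate_append, Matches] at hw
    · subst hw
      -- The empty word is a history for initial value `0` only; here positivity of `n` is
      -- essential.
      exact fun h => hn.ne' (IsHistory.eq_zero_of_replicate (j := 0) h).1
    · obtain ⟨x, _, _, rfl, _, rfl, rfl⟩ := hw
      exact fun h => h.getLast?_ne getLast?_concat
    · trivial
    · subst hw
      exact fun h => by simp at h
    · obtain ⟨x, _, _, rfl, _, ⟨c, hc, rfl⟩, _, rfl, rfl⟩ := hw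
      exact fun h => hc (by simpa using h)
    · subst hw
      exact fun h => by simp at h
    · obtain ⟨_, ⟨c, hc, rfl⟩, _, rfl, x, _, _, rfl, rfl⟩ := hw
      exact fun h => hc (by simpa using h)
    · exact ⟨0, hw⟩
    · obtain ⟨_, rfl, _, ⟨j, rfl⟩, _, rfl, rfl⟩ := hw
      exact ⟨j + 1, by simp [replicate_succ]⟩
    · exact ⟨0, hw⟩
    · obtain ⟨_, rfl, _, ⟨q, rfl⟩, _, rfl, rfl⟩ := hw
      exact ⟨q + 1, by rw [mul_add, mul_one, add_comm]; simp [-replicate_append_replicate, replicate_add]⟩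
  · trivial
  · obtain ⟨_, rfl, rfl⟩ := hw
    exact ⟨c, hc, rfl⟩
  · simp only [map_cons, map_nil, symbolOfSum, Matches] at hw
    obtain ⟨x, hx, _, rfl, _, ⟨q, c, j, hc, hj, rfl⟩, _, rfl, y, hy, _, rfl, rfl⟩ := hw
    intro h
    refine hj ((IsHistory.eq_of_adjacent (m := n) (b := j) (a := r + M * q) hx hy hc ?_).trans (hg r hr q))
    simpa using h
  · exact mem_of_matches_mismatchRules hp hw

theorem mem_of_matches_initialValueRules {p : ℕ × List (Fin k ⊕ ℕ)}
    (hp : p ∈ initialValueRules u n) {w : List (Fin k)}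
    (hw : Matches (nonHistoryLanguages u M g a n) (p.2.map symbolOfSum) w) :
    w ∈ nonHistoryLanguages u M g a n p.1 := by
  simp only [initialValueRules, mem_cons, List.mem_map, mem_range] at hp
  rcases hp with rfl | ⟨j, hj, rfl⟩ <;>
    simp only [map_append, map_cons, map_replicate, map_nil, symbolOfSum,
      matches_replicate_append, Matches] at hw
  · obtain ⟨_, rfl, x, _, _, rfl, rfl⟩ := hw
    exact IsHistory.not_replicate_append
  · obtain ⟨_, rfl, _, ⟨c, hc, rfl⟩, _, rfl, x, _, _, rfl, rfl⟩ := hw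
    exact fun h => hj.ne (h.of_cons hc).1

theorem not_isHistory_of_mem_language (hg : ∀ r < M, ∀ q, g (r + M * q) = g r + a r * q)
    (hn : 0 < n) {w : List (Fin k)}
    (hw : w ∈ (nonHistoryGrammar u M g a n).toGrammar.language) : ¬ IsHistory u g n w := by
  refine mem_of_mem_language_of_matches (G := (nonHistoryGrammar u M g a n).toGrammar)
    (I := nonHistoryLanguages u M g a n) (fun r hr w hw => ?_) w hw
  obtain ⟨p, hp, rfl⟩ := (GrammarCode.mem_rules _ r).1 hr
  rcases mem_append.1 hp with hp | hp
  · exact mem_of_matches_commonRules hg hn hp hw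
  · exact mem_of_matches_initialValueRules hp hw

end HistoryGrammar

/-! ### The grammar of non-histories: completeness and universality -/

section HistoryGrammar

open List ContextFreeGrammar

variable {k : ℕ} {u : Fin k} {M : ℕ} {g a : ℕ → ℕ} {n : ℕ}

variable (u M g a n) in
/-- The words derived from a nonterminal of `nonHistoryGrammar`. -/
def nonHistoryDerived (A : ℕ) : Language (Fin k) :=
  (nonHistoryGrammar u M g a n).toGrammar.derivedFrom A

theorem mem_nonHistoryDerived_of_mem_commonRules {p : ℕ × List (Fin k ⊕ ℕ)}
    (hp : p ∈ commonRules u M g a) {w : List (Fin k)}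
    (hw : Matches (nonHistoryDerived u M g a n) (p.2.map symbolOfSum) w) :
    w ∈ nonHistoryDerived u M g a n p.1 :=
  mem_derivedFrom_of_rule (G := (nonHistoryGrammar u M g a n).toGrammar)
    ((GrammarCode.mem_rules _ _).2 ⟨p, mem_append_left _ hp, rfl⟩) hw

theorem mem_nonHistoryDerived_of_mem_initialValueRules {p : ℕ × List (Fin k ⊕ ℕ)}
    (hp : p ∈ initialValueRules u n) {w : List (Fin k)}
    (hw : Matches (nonHistoryDerived u M g a n) (p.2.map symbolOfSum) w) :
    w ∈ nonHistoryDerived u M g a n p.1 :=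
  mem_derivedFrom_of_rule (G := (nonHistoryGrammar u M g a n).toGrammar)
    ((GrammarCode.mem_rules _ _).2 ⟨p, mem_append_right _ hp, rfl⟩) hw

theorem mem_nonHistoryDerived_of_mem_mismatchRules {r : ℕ} (hr : r < M) {p : ℕ × List (Fin k ⊕ ℕ)}
    (hp : p ∈ mismatchRules u M r (g r) (a r)) {w : List (Fin k)}
    (hw : Matches (nonHistoryDerived u M g a n) (p.2.map symbolOfSum) w) :
    w ∈ nonHistoryDerived u M g a n p.1 :=
  mem_nonHistoryDerived_of_mem_commonRules
    (mem_append_right _ (mem_flatMap.2 ⟨r, mem_range.2 hr, hp⟩)) hw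

theorem mem_nonHistoryDerived_one (w : List (Fin k)) : w ∈ nonHistoryDerived u M g a n 1 := by
  induction w with
  | nil => exact mem_nonHistoryDerived_of_mem_commonRules (p := (1, [])) (by simp [commonRules]) rfl
  | cons c w ih =>
    exact mem_nonHistoryDerived_of_mem_commonRules (p := (1, [.inl c, .inr 1])) (by simp [commonRules])
      ⟨w, rfl, w, ih, [], by simp, rfl⟩

theorem mem_nonHistoryDerived_four {c : Fin k} (hc : c ≠ u) :
    [c] ∈ nonHistoryDerived u M g a n 4 :=
  mem_nonHistoryDerived_of_mem_commonRules (p := (4, [.inl c])) (by simp [commonRules, hc])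
    ⟨[], rfl, rfl⟩

theorem mem_nonHistoryDerived_two {w : List (Fin k)} (hw : w.getLast? ≠ some u) :
    w ∈ nonHistoryDerived u M g a n 2 := by
  rcases eq_nil_or_concat' w with rfl | ⟨v, c, rfl⟩
  · exact mem_nonHistoryDerived_of_mem_commonRules (p := (2, [])) (by simp [commonRules]) rfl
  · rw [getLast?_concat] at hw
    exact mem_nonHistoryDerived_of_mem_commonRules (p := (2, [.inr 1, .inr 4])) (by simp [commonRules])
      ⟨v, mem_nonHistoryDerived_one v, [c], rfl, [c],
        mem_nonHistoryDerived_four (by simpa using hw), [], rfl, rfl⟩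

theorem mem_nonHistoryDerived_three {w : List (Fin k)} (hw : w.head? ≠ some u) :
    w ∈ nonHistoryDerived u M g a n 3 := by
  cases w with
  | nil => exact mem_nonHistoryDerived_of_mem_commonRules (p := (3, [])) (by simp [commonRules]) rfl
  | cons c v =>
    exact mem_nonHistoryDerived_of_mem_commonRules (p := (3, [.inr 4, .inr 1])) (by simp [commonRules])
      ⟨[c], mem_nonHistoryDerived_four (by simpa using hw), v, rfl, v,
        mem_nonHistoryDerived_one v, [], by simp, rfl⟩

theorem replicate_mem_nonHistoryDerived_five (j : ℕ) :
    replicate j u ∈ nonHistoryDerived u M g a n 5 := by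
  induction j with
  | zero => exact mem_nonHistoryDerived_of_mem_commonRules (p := (5, [])) (by simp [commonRules]) rfl
  | succ j ih =>
    exact mem_nonHistoryDerived_of_mem_commonRules (p := (5, [.inl u, .inr 5])) (by simp [commonRules])
      ⟨_, rfl, _, ih, [], by simp, rfl⟩

theorem replicate_mem_nonHistoryDerived_six (q : ℕ) :
    replicate (M * q) u ∈ nonHistoryDerived u M g a n 6 := by
  induction q with
  | zero => exact mem_nonHistoryDerived_of_mem_commonRules (p := (6, [])) (by simp [commonRules]) rfl
  | succ q ih =>
    refine mem_nonHistoryDerived_of_mem_commonRules (p := (6, replicate M (.inl u) ++ [.inr 6]))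
      (by simp [commonRules]) ?_
    simp only [map_append, map_replicate, symbolOfSum, matches_replicate_append]
    exact ⟨_, by rw [mul_add, mul_one, add_comm, replicate_add], _, ih, [], by simp, rfl⟩

/-- The recursive rule keeps the two sides in step: increasing the argument by `M` increases the
value by `a r`, so a mismatch stays a mismatch. -/
theorem wrap_mem_nonHistoryDerived {r : ℕ} (hr : r < M) (q : ℕ) {w : List (Fin k)}
    (hw : w ∈ nonHistoryDerived u M g a n (r + 7)) :
    replicate (M * q) u ++ (w ++ replicate (a r * q) u) ∈ nonHistoryDerived u M g a n (r + 7) := by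
  induction q with
  | zero => simpa using hw
  | succ q ih =>
    refine mem_nonHistoryDerived_of_mem_mismatchRules hr
      (p := (r + 7, replicate M (.inl u) ++ .inr (r + 7) :: replicate (a r) (.inl u)))
      (by simp [mismatchRules]) ?_
    simp only [map_append, map_cons, map_replicate, symbolOfSum, matches_replicate_append,
      matches_replicate, Matches]
    refine ⟨_, ?_, _, ih, _, rfl, rfl⟩
    rw [mul_add, mul_one, add_comm, replicate_add, mul_add, mul_one, replicate_add]
    simp only [append_assoc]

/-- One core rule for each way to miss `g r + a r * q`. If `a r * q ≤ j` but `j` is too small,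
unwrapping `q` times leaves fewer than `g r` digits on the right. If `j < a r * q`, the right side
is exhausted first and surplus blocks of `M` remain on the left. If `j` is too large, unwrapping
leaves more than `g r` digits on the right. -/
theorem mismatch_mem_nonHistoryDerived {r : ℕ} (hr : r < M) {q j : ℕ} {c : Fin k} (hc : c ≠ u)
    (hj : j ≠ g r + a r * q) :
    replicate (r + M * q) u ++ c :: replicate j u ∈ nonHistoryDerived u M g a n (r + 7) := by
  have h4 : [c] ∈ nonHistoryDerived u M g a n 4 := mem_nonHistoryDerived_four hc
  rcases lt_or_gt_of_ne hj with h | h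
  · rcases le_or_gt (a r * q) j with hle | hlt
    · obtain ⟨i, rfl⟩ := Nat.exists_eq_add_of_le' hle
      have h0 : replicate r u ++ c :: replicate i u ∈ nonHistoryDerived u M g a n (r + 7) := by
        refine mem_nonHistoryDerived_of_mem_mismatchRules hr
          (p := (r + 7, replicate r (.inl u) ++ .inr 4 :: replicate i (.inl u))) ?_ ?_
        · have : i < g r := by omega
          simp [mismatchRules, this]
        · simp only [map_append, map_cons, map_replicate, symbolOfSum, matches_replicate_append,
            matches_replicate, Matches]
          exact ⟨_, rfl, _, h4, _, rfl, rfl⟩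
      have := wrap_mem_nonHistoryDerived hr q h0
      rw [add_comm r (M * q), replicate_add, replicate_add]
      simpa only [append_assoc, cons_append] using this
    · have ha : 0 < a r := Nat.pos_of_ne_zero fun h0 => by simp [h0] at hlt
      have hq : j / a r < q := Nat.div_lt_of_lt_mul hlt
      -- The right side allows `j / a r` wrappings and leaves `j % a r` digits; the other `d + 1`
      -- blocks of `M` on the left are unmatched.
      obtain ⟨d, hd⟩ := Nat.exists_eq_add_of_lt hq
      have h0 : replicate M u ++ (replicate (M * d) u ++ (replicate r u ++
          c :: replicate (j % a r) u)) ∈ nonHistoryDerived u M g a n (r + 7) := by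
        refine mem_nonHistoryDerived_of_mem_mismatchRules hr
          (p := (r + 7, replicate M (.inl u) ++ .inr 6 :: (replicate r (.inl u) ++
            .inr 4 :: replicate (j % a r) (.inl u)))) ?_ ?_
        · have := Nat.mod_lt j ha
          simp [mismatchRules, this]
        · simp only [map_append, map_cons, map_replicate, symbolOfSum, matches_replicate_append,
            matches_replicate, Matches]
          exact ⟨_, rfl, _, replicate_mem_nonHistoryDerived_six d, _, rfl, _, rfl, _, h4, _, rfl,
            rfl⟩
      have := wrap_mem_nonHistoryDerived hr (j / a r) h0
      have e1 : r + M * q = M * (j / a r) + (M + (M * d + r)) := by rw [hd]; ring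
      rw [e1]
      conv =>
        enter [2, 2, 2]
        rw [← Nat.mod_add_div j (a r)]
      simp only [replicate_add]
      simpa only [append_assoc, cons_append] using this
  · obtain ⟨d, rfl⟩ := Nat.exists_eq_add_of_lt h
    have h0 : replicate r u ++ c :: (replicate (g r + 1) u ++ replicate d u) ∈
        nonHistoryDerived u M g a n (r + 7) := by
      refine mem_nonHistoryDerived_of_mem_mismatchRules hr
        (p := (r + 7, replicate r (.inl u) ++ .inr 4 :: (replicate (g r + 1) (.inl u) ++ [.inr 5])))
        (by simp [mismatchRules]) ?_
      simp only [map_append, map_cons, map_replicate, map_nil, symbolOfSum,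
        matches_replicate_append, Matches]
      exact ⟨_, rfl, _, h4, _, rfl, _, rfl, _, replicate_mem_nonHistoryDerived_five d, [],
        by simp, rfl⟩
    have := wrap_mem_nonHistoryDerived hr q h0
    have e1 : g r + a r * q + d + 1 = (g r + 1) + (d + a r * q) := by ring
    rw [e1, add_comm r (M * q)]
    simp only [replicate_add (M * q), replicate_add (g r + 1), replicate_add d]
    simpa only [append_assoc, cons_append] using this

/-- By contraposition: an underivable word shows none of the defects the grammar can produce, so its
last letter, its adjacent values and its first value are right, which makes it a history. -/
theorem mem_language_of_not_isHistory (hM : 0 < M)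
    (hg : ∀ r < M, ∀ q, g (r + M * q) = g r + a r * q) {w : List (Fin k)}
    (hw : ¬ IsHistory u g n w) : w ∈ (nonHistoryGrammar u M g a n).toGrammar.language := by
  change w ∈ nonHistoryDerived u M g a n 0
  by_contra hmem
  refine hw ?_
  have hlast : w.getLast? ≠ some u := by
    intro h
    obtain ⟨v, rfl⟩ := getLast?_eq_some_iff.1 h
    exact hmem (mem_nonHistoryDerived_of_mem_commonRules (p := (0, [.inr 1, .inl u]))
      (by simp [commonRules]) ⟨v, mem_nonHistoryDerived_one v, [u], rfl, [], rfl, rfl⟩)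
  have hadj : ∀ x i c j y, w = x ++ (replicate i u ++ c :: (replicate j u ++ y)) → c ≠ u →
      x.getLast? ≠ some u → y.head? ≠ some u → j = g i := by
    intro x i c j y h hc hx hy
    by_contra hne
    have hr := Nat.mod_lt i hM
    refine hmem (mem_nonHistoryDerived_of_mem_commonRules (p := (0, [.inr 2, .inr (i % M + 7), .inr 3]))
      (by simp [commonRules, hr]) ⟨x, mem_nonHistoryDerived_two hx, _, h,
        replicate i u ++ c :: replicate j u, ?_, y, by simp, y, mem_nonHistoryDerived_three hy, [],
        by simp, rfl⟩)
    have := mismatch_mem_nonHistoryDerived (n := n) (g := g) (a := a) hr (q := i / M) hc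
      (j := j) (by rwa [← hg _ hr, Nat.mod_add_div])
    rwa [Nat.mod_add_div] at this
  rcases eq_replicate_or_exists_ne u w with ⟨j, rfl⟩ | ⟨j, c, v, hc, rfl⟩
  · cases j with
    | zero =>
      exact absurd (mem_nonHistoryDerived_of_mem_commonRules (p := (0, [])) (by simp [commonRules]) rfl)
        hmem
    | succ j => simp [replicate_succ'] at hlast
  · have hv := IsHistory.of_forall_adjacent hlast hadj (x := []) rfl hc (by simp)
    rcases lt_trichotomy j n with h | rfl | h
    · refine absurd (mem_nonHistoryDerived_of_mem_initialValueRules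
        (p := (0, replicate j (.inl u) ++ [.inr 4, .inr 1])) (by simp [initialValueRules, h]) ?_)
        hmem
      simp only [map_append, map_cons, map_replicate, map_nil, symbolOfSum,
        matches_replicate_append, Matches]
      exact ⟨_, rfl, _, mem_nonHistoryDerived_four hc, v, rfl, v, mem_nonHistoryDerived_one v, [],
        by simp, rfl⟩
    · exact .cons hc hv
    · obtain ⟨d, rfl⟩ := Nat.exists_eq_add_of_lt h
      refine absurd (mem_nonHistoryDerived_of_mem_initialValueRules
        (p := (0, replicate (n + 1) (.inl u) ++ [.inr 1])) (by simp [initialValueRules]) ?_) hmem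
      simp only [map_append, map_cons, map_replicate, map_nil, symbolOfSum,
        matches_replicate_append, Matches]
      refine ⟨replicate d u ++ c :: v, ?_, _, mem_nonHistoryDerived_one _, [],
        (append_nil _).symm, rfl⟩
      rw [add_right_comm, replicate_add, append_assoc]

theorem language_nonHistoryGrammar_eq_top_iff {z : Fin k} (hz : z ≠ u) (hM : 0 < M)
    (hg : ∀ r < M, ∀ q, g (r + M * q) = g r + a r * q) (hn : 0 < n) :
    (nonHistoryGrammar u M g a n).toGrammar.language = ⊤ ↔ ¬ ∃ t, g^[t] n = 0 := by
  rw [← IsHistory.exists_iff hz, not_exists]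
  constructor
  · intro h w
    refine not_isHistory_of_mem_language hg hn (M := M) (a := a) ?_
    rw [h]
    trivial
  · intro h
    refine eq_top_iff.2 fun w _ => ?_
    exact mem_language_of_not_isHistory hM hg (h w)

/-- Only the initial-value rules vary with `n`. All others form a constant list, so nothing about
computability of `g` and `a` is needed. -/
theorem primrec_nonHistoryGrammar : Primrec (nonHistoryGrammar u M g a) := by
  have hrep : Primrec fun j : ℕ => replicate j (Sum.inl u : Fin k ⊕ ℕ) :=
    (Primrec.list_map Primrec.list_range (Primrec₂.const (Sum.inl u))).of_eq fun j => by
      simp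
  have hrule : Primrec fun j : ℕ =>
      ((0, replicate j (.inl u) ++ [.inr 4, .inr 1]) : ℕ × List (Fin k ⊕ ℕ)) :=
    (Primrec.const 0).pair (Primrec.list_append.comp hrep (Primrec.const _))
  have hfirst : Primrec fun n : ℕ =>
      ((0, replicate (n + 1) (.inl u) ++ [.inr 1]) : ℕ × List (Fin k ⊕ ℕ)) :=
    (Primrec.const 0).pair (Primrec.list_append.comp (hrep.comp Primrec.succ) (Primrec.const _))
  have hinit : Primrec (initialValueRules u) :=
    Primrec.list_cons.comp hfirst (Primrec.list_map Primrec.list_range (hrule.comp₂ .right))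
  exact (Primrec.const 0).pair (Primrec.list_append.comp (Primrec.const _) hinit)

end HistoryGrammar

/-! ### The two values of the free energy -/

section FreeEnergy

theorem partitionSum_zero {α : Type} [Fintype α] (L : Language α) (n : ℕ) :
    partitionSum (fun _ _ => 0) L n = Nat.card {x : Fin n → α // List.ofFn x ∈ L} := by
  classical
  have h : ∀ w : List α, wordCost (fun _ _ => 0) w = 0 := fun w =>
    List.sum_eq_zero fun y hy => by
      rw [← List.map_uncurry_zip_eq_zipWith, List.mem_map] at hy
      obtain ⟨_, _, rfl⟩ := hy
      rfl
  simp only [partitionSum, h, Real.exp_zero, Finset.sum_const, nsmul_eq_mul, mul_one]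
  rw [Nat.card_eq_fintype_card, Fintype.card_subtype]

theorem freeEnergy_complMulAll_top {α : Type} [Fintype α] :
    freeEnergy (fun _ _ => 0) (complMulAll (⊤ : Language α)) = 0 := by
  have h : ∀ w, w ∉ complMulAll (⊤ : Language α) := by
    intro w hw
    obtain ⟨x, hx, -⟩ := Language.mem_mul.1 hw
    exact hx trivial
  have h0 : ∀ n, partitionSum (fun _ _ => 0) (complMulAll (⊤ : Language α)) n = 0 := by
    intro n
    rw [partitionSum_zero, Nat.cast_eq_zero]
    exact Nat.card_eq_zero.2 (.inl ⟨fun x => h _ x.2⟩)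
  simp [freeEnergy, h0]

theorem freeEnergy_complMulAll_of_ne_top {k : ℕ} (hk : 2 ≤ k) {L : Language (Fin k)}
    (hL : L ≠ ⊤) : freeEnergy (fun _ _ => 0) (complMulAll L) = Real.log k := by
  obtain ⟨w, hw⟩ : ∃ w, w ∉ L := by
    by_contra! h
    exact hL (eq_top_iff.2 fun w _ => h w)
  have hk0 : (0 : ℝ) < k := by exact_mod_cast (by omega : 0 < k)
  have hlog : 0 ≤ Real.log k := Real.log_natCast_nonneg k
  -- Every word that starts with the excluded word `w` is in `L'`, and the remaining `d` letters are
  -- free.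
  have hlower : ∀ d, k ^ d ≤
      Nat.card {x : Fin (w.length + d) → Fin k // List.ofFn x ∈ complMulAll L} := by
    intro d
    let φ : (Fin d → Fin k) → {x : Fin (w.length + d) → Fin k // List.ofFn x ∈ complMulAll L} :=
      fun y => ⟨Fin.append w.get y, by
        rw [List.ofFn_fin_append, List.ofFn_get]
        exact Language.mem_mul.2 ⟨w, hw, _, trivial, rfl⟩⟩
    have hφ : Function.Injective φ := by
      intro y y' h
      funext i
      have := congrFun (congrArg Subtype.val h) (Fin.natAdd _ i)
      simpa [φ] using this
    simpa using Nat.card_le_card_of_injective φ hφ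
  have hupper : ∀ n, Nat.card {x : Fin n → Fin k // List.ofFn x ∈ complMulAll L} ≤ k ^ n := by
    intro n
    simpa using Nat.card_le_card_of_injective
      (Subtype.val : {x : Fin n → Fin k // List.ofFn x ∈ complMulAll L} → _)
      Subtype.val_injective
  refine Tendsto.limsup_eq ?_
  have hlim : Tendsto (fun n : ℕ => Real.log k - w.length * Real.log k / (n : ℝ)) atTop
      (nhds (Real.log k)) := by
    simpa using (tendsto_const_nhds (x := Real.log k)).sub
      (tendsto_const_div_atTop_nhds_zero_nat (w.length * Real.log k))
  refine tendsto_of_tendsto_of_tendsto_of_le_of_le' hlim tendsto_const_nhds ?_ ?_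
  -- The extra `1` keeps `n` positive even when `w` is empty, so that division by `n` is harmless.
  · filter_upwards [eventually_ge_atTop (w.length + 1)] with n hn
    obtain ⟨d, rfl⟩ := Nat.exists_eq_add_of_le ((Nat.le_succ _).trans hn)
    have hn0 : (0 : ℝ) < (w.length + d : ℕ) := by exact_mod_cast (by omega : 0 < w.length + d)
    rw [partitionSum_zero]
    have h1 : (k : ℝ) ^ d ≤
        Nat.card {x : Fin (w.length + d) → Fin k // List.ofFn x ∈ complMulAll L} := by
      exact_mod_cast hlower d
    have h2 := Real.log_le_log (pow_pos hk0 d) h1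
    rw [Real.log_pow] at h2
    calc _ = 1 / ((w.length + d : ℕ) : ℝ) * (d * Real.log k) := by
          field_simp
          push_cast
          ring
      _ ≤ _ := mul_le_mul_of_nonneg_left h2 (by positivity)
  · filter_upwards [eventually_ge_atTop (w.length + 1)] with n hn
    obtain ⟨d, rfl⟩ := Nat.exists_eq_add_of_le ((Nat.le_succ _).trans hn)
    have hn0 : (0 : ℝ) < (w.length + d : ℕ) := by exact_mod_cast (by omega : 0 < w.length + d)
    rw [partitionSum_zero, one_div, inv_mul_le_iff₀ hn0, ← Real.log_pow]
    refine Real.log_le_log ?_ (by exact_mod_cast hupper _)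
    have := (Nat.pow_pos (n := d) (by omega : 0 < k)).trans_le (hlower d)
    exact_mod_cast this

end FreeEnergy

/-! ### Undecidability of universality and the main theorem -/

/-- Universality of context-free grammars is undecidable. -/
theorem not_computablePred_language_eq_top {k : ℕ} (hk : 2 ≤ k) :
    ¬ ComputablePred fun G : GrammarCode k => G.toGrammar.language = ⊤ := by
  intro hdec
  -- The value is `0` exactly when the program with code `x`, run on input `0`, gives a result
  -- within the bound `m`; a zero of `f x` is thus a witness of halting.
  let f : ℕ → ℕ → ℕ := fun x m =>
    if (Nat.Partrec.Code.evaln m (Denumerable.ofNat _ x) 0).isSome then 0 else 1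
  have hf : Primrec₂ f := by
    refine Primrec.ite (PrimrecPred.comp (p := fun b : Bool => b = true) ?_ ?_) (.const _) (.const _)
    · exact Primrec.eq.comp .id (.const _)
    · exact Primrec.option_isSome.comp (Nat.Partrec.Code.primrec_evaln.comp
        ((Primrec.snd.pair ((Primrec.ofNat _).comp .fst)).pair (.const 0)))
  obtain ⟨g, ⟨M, hM, hg⟩, ι, hι, hpos, hhalt⟩ :=
    exists_residueAffine_iterate_eq_zero_iff hf fun x m => by simp only [f]; split_ifs <;> omega
  choose! a ha using hg
  have hred : ∀ c : Nat.Partrec.Code, (nonHistoryGrammar (⟨0, by omega⟩ : Fin k) M g a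
      (ι (Encodable.encode c))).toGrammar.language = ⊤ ↔ ¬ (Nat.Partrec.Code.eval c 0).Dom := by
    intro c
    rw [language_nonHistoryGrammar_eq_top_iff (z := ⟨1, by omega⟩) (by simp) hM ha (hpos _), hhalt,
      not_iff_not, Part.dom_iff_mem]
    simp only [f, Denumerable.ofNat_encode, ite_eq_left_iff, one_ne_zero, imp_false, not_not,
      Option.isSome_iff_exists, Nat.Partrec.Code.evaln_complete, Option.mem_def]
    exact exists_comm
  have hcomp : ComputablePred fun c : Nat.Partrec.Code => ¬ (Nat.Partrec.Code.eval c 0).Dom :=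
    ComputablePred.computable_of_manyOneReducible
      ⟨_, (primrec_nonHistoryGrammar.comp (hι.comp .encode)).to_comp, fun c => (hred c).symm⟩ hdec
  exact ComputablePred.halting_problem 0 (by simpa using hcomp.not)

theorem theorem1 (k : ℕ) (hk : 2 ≤ k) :
    (∀ L : Language (Fin k), L.IsContextFree →
      (L = ⊤ → freeEnergy (fun _ _ => 0) (complMulAll L) = 0) ∧
      (L ≠ ⊤ → freeEnergy (fun _ _ => 0) (complMulAll L) = Real.log k)) ∧
    ¬ ComputableReal (fun g : GrammarCode k =>
        freeEnergy (fun _ _ => 0) (complMulAll g.toGrammar.language)) := by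
  refine ⟨fun L _ => ⟨fun h => h ▸ freeEnergy_complMulAll_top,
    freeEnergy_complMulAll_of_ne_top hk⟩, ?_⟩
  rintro ⟨z, hz, happrox⟩
  refine not_computablePred_language_eq_top hk ?_
  -- Precision `2` means error at most `1/4`: the value `0` forces `|z| ≤ 1`, while a value of at
  -- least `ln 2 > 0.69` forces `z ≥ 4 * ln 2 - 1 > 1`.
  have hiff : ∀ G : GrammarCode k,
      (z G 2 = -1 ∨ z G 2 = 0 ∨ z G 2 = 1) ↔ G.toGrammar.language = ⊤ := by
    intro G
    have h := abs_le.1 (happrox G 2)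
    by_cases hG : G.toGrammar.language = ⊤
    · refine iff_of_true ?_ hG
      simp only [hG, freeEnergy_complMulAll_top] at h
      have h1 : (-1 : ℝ) ≤ z G 2 := by linarith [h.1]
      have h2 : (z G 2 : ℝ) ≤ 1 := by linarith [h.2]
      have h1' : -1 ≤ z G 2 := by exact_mod_cast h1
      have h2' : z G 2 ≤ 1 := by exact_mod_cast h2
      omega
    · refine iff_of_false ?_ hG
      simp only [freeEnergy_complMulAll_of_ne_top hk hG] at h
      have hlog : Real.log 2 ≤ Real.log k := Real.log_le_log two_pos (by exact_mod_cast hk)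
      have h1 : (1 : ℝ) < z G 2 := by linarith [h.1, Real.log_two_gt_d9]
      have h1' : 1 < z G 2 := by exact_mod_cast h1
      omega
  have hp : PrimrecPred fun i : ℤ => i = -1 ∨ i = 0 ∨ i = 1 :=
    (Primrec.eq.comp .id (.const _)).or
      ((Primrec.eq.comp .id (.const _)).or (Primrec.eq.comp .id (.const _)))
  refine ComputablePred.computable_of_manyOneReducible
    ⟨fun G => z G 2, hz.comp .id (.const 2), fun G => (hiff G).symm⟩ hp.computablePred
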